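/- Let $G$ be a compact connected Lie group with Lie algebra $\mathfrak g$, let $H$ be the identity component of its centre, $\mathfrak h=\mathrm{Lie}(H)$, and $S=[G,G]$. Let $\Sigma$ be a closed connected oriented surface of genus $\ell\ge 1$ with base point $Q$, and let $u_1,v_1,\dots,u_\ell,v_\ell$ be a canonical system of smooth closed curves based at $Q$: they are simple, meet only at $Q$, and cutting $\Sigma$ along them yields an open disk whose positively oriented boundary path reads $\prod_j u_jv_ju_j^{-1}v_j^{-1}$ (products of loops are read from right to left, so that holonomy is multiplicative). Let $F$ be the free group on $x_1,y_1,\dots,x_\ell,y_\ell$, let $r=\prod_j[x_j,y_j]$, let $N$ be the normal closure of $r$ in $F$, and let $\Gamma=F/[F,N]$. Fix a smooth principal $\mathrm U(1)$-bundle $M\to\Sigma$ of Chern class $1$ with a connection of nondegenerate curvature $-2\pi i\,\mathrm{vol}_\Sigma$, where $\mathrm{vol}_\Sigma$ is positive for the orientation of $\Sigma$ (so $\int_\Sigma \mathrm{vol}_\Sigma=1$), a base point of $M$ over $Q$, closed lifts to $M$ of the canonical curves starting there (they identify $\Gamma$ with $\pi_1(M)$), and a universal covering $\widetilde M\to M$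 with a base point over that of $M$. Then $\Gamma$ acts on $\widetilde M$ from the right by deck transformations, and $\mathbb R$ acts on $\widetilde M$ by lifting the $\mathrm U(1)$-action along $t\mapsto e^{it}$. Let $\xi\colon P\to\Sigma$ be a smooth principal $G$-bundle ($G$ acting from the right), and let $X_\xi\in\mathfrak h$ be its topological characteristic class: $P/S$ is isomorphic to the bundle obtained from $M$ by extension of the structure group along $\mathrm U(1)\to G/S$, $e^{2\pi i t}\mapsto \exp(tX_\xi)S$. For a homomorphism $\chi\colon\Gamma\to G$ with $\chi([r])=\exp(X_\xi)$, let $\xi_\chi$ be the principal $G$-bundle on $\Sigma$ with total space $\widetilde M\times_\chi G$, the quotient of $\widetilde M\times G$ by the identifications $(m\cdot\gamma,g)\sim(m,\chi(\gamma)g)$ for $\gamma\in\Gamma$ and $(m\cdot 2\pi t,g)\sim(m,\exp(tX_\xi)g)$ for $t\in\mathbb R$. Let $\mathrm{Hom}_{X_\xi}(\Gamma,G)_\xi$ be the space of those $\chi$ with $\chi([r])=\exp(X_\xi)$ for which $\xi_\chi$ is isomorphic to $\xi$, viewed as a subspace of $\mathrm{Hom}(F,G)\cong G^{2\ell}$.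 It is stratified by the connected components of the subspaces of points of a given orbit type under conjugation by $G$; a map is smooth on a stratum if it extends locally to a smooth map between open subsets of $G^{2\ell}$. Let $\mathcal B_{\xi,Q}$ be the space of smooth connections on $\xi$ modulo smooth gauge transformations that are the identity on the fibre over $Q$. For $q\in P$ over $Q$ and a loop $w$ at $Q$, define $\mathrm{Hol}_{w,q}(A)\in G$ by the requirement that the $A$-horizontal lift of $w$ starting at $q$ ends at $q\cdot\mathrm{Hol}_{w,q}(A)$. The Wilson loop mapping relative to $q$ is $$\rho_{\flat,q}\colon\mathcal B_{\xi,Q}\to G^{2\ell},\quad [A]\mapsto\big(\mathrm{Hol}_{u_1,q}(A),\mathrm{Hol}_{v_1,q}(A),\dots,\mathrm{Hol}_{u_\ell,q}(A),\mathrm{Hol}_{v_\ell,q}(A)\big).$$ Let $\mathcal{CYM}_{\xi,Q}\subseteq\mathcal B_{\xi,Q}$ be the subspace cut out by the constraints $\mathrm{Hol}_{w,q}(A)=\exp(a_\Delta X_\xi)$ for all smooth loops $w$ at $Q$ that bound a disk $\Delta$ in $\Sigma$, where $a_\Delta=\int_\Delta\mathrm{vol}_\Sigma$ and $\Delta$ is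 oriented by $w$. When $\rho_{\flat,q}$ takes $\mathcal{CYM}_{\xi,Q}$ into $\mathrm{Hom}_{X_\xi}(\Gamma,G)_\xi$, let $\rho^\sharp_q\colon\mathcal{CYM}_{\xi,Q}\to\mathrm{Hom}_{X_\xi}(\Gamma,G)_\xi$ denote the resulting map. **Proposition.** Let $Q_P\in P$ be a point over $Q$ and let $x\in G$. Then: 1. The subspaces $\mathcal{CYM}_{\xi,Q}$ defined by means of $q=Q_P$ and of $q=Q_P\cdot x$ coincide. 2. Conjugation by $x$, $\chi\mapsto x\chi x^{-1}$, restricts to a homeomorphism $\kappa_x$ of $\mathrm{Hom}_{X_\xi}(\Gamma,G)_\xi$ onto itself which is an automorphism of stratified spaces: it and its inverse take strata onto strata and are smooth on each stratum. 3. $\rho_{\flat,Q_P}(b)=x\,\rho_{\flat,Q_P\cdot x}(b)\,x^{-1}$ for every $b\in\mathcal B_{\xi,Q}$. In particular, the two maps $\rho^\sharp$ differ by $\kappa_x$: $$\rho^\sharp_{Q_P}=\kappa_x\circ\rho^\sharp_{Q_P\cdot x}\colon\ \mathcal{CYM}_{\xi,Q}\to\mathrm{Hom}_{X_\xi}(\Gamma,G)_\xi.$$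 -/

import Mathlib

open scoped Manifold ContDiff
open Set

noncomputable section

namespace YangMillsWilson

/-! ### Lie groups: exponential map, adjoint action, Lie algebra of the centre -/

section LieGroups

variable {EG : Type*} [NormedAddCommGroup EG] [NormedSpace ℝ EG]
  {G : Type*} [TopologicalSpace G] [ChartedSpace EG G] [Group G]

/-- `γ` is the smooth one-parameter subgroup of `G` with initial velocity `X`. -/
structure IsOneParameterSubgroup (X : GroupLieAlgebra 𝓘(ℝ, EG) G) (γ : ℝ → G) : Prop where
  map_add : ∀ s t, γ (s + t) = γ s * γ t
  map_zero : γ 0 = 1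
  smooth : ContMDiff 𝓘(ℝ, ℝ) 𝓘(ℝ, EG) ∞ γ
  velocity : (mfderiv 𝓘(ℝ, ℝ) 𝓘(ℝ, EG) γ 0 (1 : ℝ) : EG) = X

open Classical in
/-- The exponential map of `G`: the value at time `1` of the one-parameter subgroup with
initial velocity `X` (it exists and is unique in every finite-dimensional Lie group). -/
def lieExp (X : GroupLieAlgebra 𝓘(ℝ, EG) G) : G :=
  if h : ∃ γ : ℝ → G, IsOneParameterSubgroup X γ then h.choose 1 else 1

/-- The adjoint action of `g` on the Lie algebra: the derivative of `h ↦ g h g⁻¹` at `1`. -/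
def lieAd (g : G) (X : GroupLieAlgebra 𝓘(ℝ, EG) G) : GroupLieAlgebra 𝓘(ℝ, EG) G :=
  (mfderiv 𝓘(ℝ, EG) 𝓘(ℝ, EG) (fun h : G => g * h * g⁻¹) 1 X : EG)

/-- `X` lies in the Lie algebra `𝔥` of the identity component `H` of the centre of `G`:
the one-parameter subgroup of `X` stays in the (closed) subgroup `Z(G)`. -/
def IsCentralVector (X : GroupLieAlgebra 𝓘(ℝ, EG) G) : Prop :=
  ∀ t : ℝ, lieExp (t • X) ∈ Subgroup.center G

end LieGroups

/-! ### Smooth principal bundles and connections -/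

section Bundles

variable {EG : Type*} [NormedAddCommGroup EG] [NormedSpace ℝ EG]
  (G : Type*) [TopologicalSpace G] [ChartedSpace EG G] [Group G]
  {EB : Type*} [NormedAddCommGroup EB] [NormedSpace ℝ EB]
  {B : Type*} [TopologicalSpace B] [ChartedSpace EB B]
  {EP : Type*} [NormedAddCommGroup EP] [NormedSpace ℝ EP]
  {P : Type*} [TopologicalSpace P] [ChartedSpace EP P] [MulAction Gᵐᵒᵖ P]

/-- `π : P → B` is a smooth principal `G`-bundle; `G` acts from the right, that is, `p · g` is
`MulOpposite.op g • p`. -/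
structure IsPrincipalBundle (π : P → B) : Prop where
  smooth_action : ContMDiff (𝓘(ℝ, EP).prod 𝓘(ℝ, EG)) 𝓘(ℝ, EP) ∞
    (fun x : P × G => MulOpposite.op x.2 • x.1)
  smooth_proj : ContMDiff 𝓘(ℝ, EP) 𝓘(ℝ, EB) ∞ π
  locally_trivial : ∀ b : B, ∃ U : Set B, IsOpen U ∧ b ∈ U ∧
    ∃ e : OpenPartialHomeomorph P (B × G), e.source = π ⁻¹' U ∧ e.target = U ×ˢ univ ∧
      ContMDiffOn 𝓘(ℝ, EP) (𝓘(ℝ, EB).prod 𝓘(ℝ, EG)) ∞ e e.source ∧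
      ContMDiffOn (𝓘(ℝ, EB).prod 𝓘(ℝ, EG)) 𝓘(ℝ, EP) ∞ e.symm e.target ∧
      ∀ p ∈ e.source, ∀ g : G, MulOpposite.op g • p ∈ e.source ∧ (e p).1 = π p ∧
        e (MulOpposite.op g • p) = ((e p).1, (e p).2 * g)

theorem IsPrincipalBundle.proj_smul {G : Type*} [TopologicalSpace G] [ChartedSpace EG G]
    [Group G] [MulAction Gᵐᵒᵖ P] {π : P → B} (h : IsPrincipalBundle (EG := EG) G (EB := EB)
      (EP := EP) π) (g : G) (p : P) : π (MulOpposite.op g • p) = π p := by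
  obtain ⟨U, -, hU, e, hs, -, -, -, he⟩ := h.locally_trivial (π p)
  have hp : p ∈ e.source := by rw [hs]; exact hU
  obtain ⟨h1, h2, h3⟩ := he p hp g
  obtain ⟨-, h4, -⟩ := he _ h1 1
  rw [← h4, h3, h2]

variable (P) [IsManifold 𝓘(ℝ, EP) ∞ P]

/-- A smooth principal connection on a principal `G`-bundle with total space `P`, given by its
connection form. -/
structure Connection where
  form : ∀ p : P, TangentSpace 𝓘(ℝ, EP) p →L[ℝ] GroupLieAlgebra 𝓘(ℝ, EG) G
  smooth : ContMDiff (𝓘(ℝ, EP).tangent) 𝓘(ℝ, EG) ∞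
    (fun v : TangentBundle 𝓘(ℝ, EP) P => (id (α := EG) (form v.proj v.snd)))
  vertical : ∀ (p : P) (X : GroupLieAlgebra 𝓘(ℝ, EG) G),
    form (MulOpposite.op (1 : G) • p)
      (mfderiv 𝓘(ℝ, EG) 𝓘(ℝ, EP) (fun g : G => MulOpposite.op g • p) 1 X) = X
  equivariant : ∀ (g : G) (p : P) (v : TangentSpace 𝓘(ℝ, EP) p),
    form (MulOpposite.op g • p)
      (mfderiv 𝓘(ℝ, EP) 𝓘(ℝ, EP) (fun q : P => MulOpposite.op g • q) p v) =
        lieAd g⁻¹ (form p v)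

variable {G P}

/-- `γ` is the horizontal lift to `P`, relative to the connection `A`, of the path
`w : [0,1] → B`, with starting point `q`. -/
structure IsHorizontalLift (π : P → B) (A : Connection (EG := EG) G (EP := EP) P) (w : ℝ → B)
    (q : P) (γ : ℝ → P) : Prop where
  smooth : ContMDiffOn 𝓘(ℝ, ℝ) 𝓘(ℝ, EP) ∞ γ (Icc 0 1)
  start : γ 0 = q
  lifts : ∀ t ∈ Icc (0 : ℝ) 1, π (γ t) = w t
  horizontal : ∀ t ∈ Icc (0 : ℝ) 1,
    A.form (γ t) (mfderivWithin 𝓘(ℝ, ℝ) 𝓘(ℝ, EP) γ (Icc 0 1) t (1 : ℝ)) = 0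

/-- `q · g` is the end point of the horizontal lift of `w` with starting point `q`. -/
def IsHolonomy (π : P → B) (A : Connection (EG := EG) G (EP := EP) P) (w : ℝ → B)
    (q : P) (g : G) : Prop :=
  ∃ γ : ℝ → P, IsHorizontalLift π A w q γ ∧ γ 1 = MulOpposite.op g • q

open Classical in
/-- The holonomy `Hol_{w,q}(A) ∈ G` of `A` along the smooth loop `w` in `B` starting at `π q`,
with reference to `q`. -/
def hol (π : P → B) (A : Connection (EG := EG) G (EP := EP) P) (w : ℝ → B) (q : P) : G :=
  if h : ∃ g : G, IsHolonomy π A w q g then h.choose else 1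

/-- `φ` is a smooth gauge transformation of `π` based at `Q`: a `G`-equivariant diffeomorphism
of `P` over the identity of `B` which is the identity on the fibre over `Q`. -/
structure IsBasedGauge (G : Type*) [Group G] [MulAction Gᵐᵒᵖ P] (π : P → B) (Q : B)
    (φ : P ≃ₘ^∞⟮𝓘(ℝ, EP), 𝓘(ℝ, EP)⟯ P) : Prop where
  equivariant : ∀ (g : G) (p : P), φ (MulOpposite.op g • p) = MulOpposite.op g • φ p
  covers : ∀ p, π (φ p) = π p
  based : ∀ p, π p = Q → φ p = p

/-- `A'` is the pull-back of `A` under a based gauge transformation. -/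
def BasedGaugeRel (π : P → B) (Q : B) (A' A : Connection (EG := EG) G (EP := EP) P) : Prop :=
  ∃ φ : P ≃ₘ^∞⟮𝓘(ℝ, EP), 𝓘(ℝ, EP)⟯ P, IsBasedGauge G π Q φ ∧
    ∀ (p : P) (v : TangentSpace 𝓘(ℝ, EP) p),
      A'.form p v = A.form (φ p) (mfderiv 𝓘(ℝ, EP) 𝓘(ℝ, EP) φ p v)

theorem IsHolonomy.of_rel {π : P → B} {Q : B} {A' A : Connection (EG := EG) G (EP := EP) P}
    (h : BasedGaugeRel π Q A' A) {q : P} (hq : π q = Q) (w : ℝ → B) (g : G) :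
    IsHolonomy π A' w q g ↔ IsHolonomy π A w q g := by
  obtain ⟨φ, hφ, hA⟩ := h
  have hfix : ∀ g : G, φ (MulOpposite.op g • q) = MulOpposite.op g • q := fun g => by
    rw [hφ.equivariant, hφ.based q hq]
  have hφd : ∀ p, MDifferentiableAt 𝓘(ℝ, EP) 𝓘(ℝ, EP) φ p := fun p =>
    φ.contMDiff.mdifferentiable (by simp) p
  have hψd : ∀ p, MDifferentiableAt 𝓘(ℝ, EP) 𝓘(ℝ, EP) φ.symm p := fun p =>
    φ.symm.contMDiff.mdifferentiable (by simp) p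
  constructor
  · rintro ⟨γ, hγ, h1⟩
    refine ⟨fun t => φ (γ t), ⟨φ.contMDiff.comp_contMDiffOn hγ.smooth, ?_, ?_, ?_⟩, ?_⟩
    · simp only [hγ.start, hφ.based q hq]
    · intro t ht
      rw [hφ.covers, hγ.lifts t ht]
    · intro t ht
      have hγd := (hγ.smooth t ht).mdifferentiableWithinAt (by simp)
      have hu : UniqueMDiffWithinAt 𝓘(ℝ, ℝ) (Icc (0 : ℝ) 1) t :=
        ((uniqueDiffOn_Icc_zero_one) t ht).uniqueMDiffWithinAt
      have hc := mfderiv_comp_mfderivWithin (x := t) (hφd (γ t)) hγd hu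
      have := hA (γ t) (mfderivWithin 𝓘(ℝ, ℝ) 𝓘(ℝ, EP) γ (Icc 0 1) t (1 : ℝ))
      rw [hγ.horizontal t ht] at this
      change A.form (φ (γ t)) (mfderivWithin 𝓘(ℝ, ℝ) 𝓘(ℝ, EP) (φ ∘ γ) (Icc 0 1) t (1 : ℝ)) = 0
      rw [hc]
      exact this.symm
    · simp only [h1, hfix]
  · rintro ⟨γ, hγ, h1⟩
    refine ⟨fun t => φ.symm (γ t), ⟨φ.symm.contMDiff.comp_contMDiffOn hγ.smooth, ?_, ?_, ?_⟩, ?_⟩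
    · simp only [hγ.start]
      conv_lhs => rw [← hφ.based q hq]
      simp
    · intro t ht
      rw [← hφ.covers, φ.apply_symm_apply, hγ.lifts t ht]
    · intro t ht
      have hγd := (hγ.smooth t ht).mdifferentiableWithinAt (by simp)
      have hu : UniqueMDiffWithinAt 𝓘(ℝ, ℝ) (Icc (0 : ℝ) 1) t :=
        ((uniqueDiffOn_Icc_zero_one) t ht).uniqueMDiffWithinAt
      have hδd : MDifferentiableWithinAt 𝓘(ℝ, ℝ) 𝓘(ℝ, EP) (φ.symm ∘ γ) (Icc 0 1) t :=
        (hψd (γ t)).comp_mdifferentiableWithinAt t hγd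
      have hc := mfderiv_comp_mfderivWithin (x := t) (hφd ((φ.symm ∘ γ) t)) hδd hu
      have he : φ ∘ (φ.symm ∘ γ) = γ := by
        funext s
        simp
      have key := hA ((φ.symm ∘ γ) t)
        (mfderivWithin 𝓘(ℝ, ℝ) 𝓘(ℝ, EP) (φ.symm ∘ γ) (Icc 0 1) t (1 : ℝ))
      have h0 := hγ.horizontal t ht
      change A'.form ((φ.symm ∘ γ) t)
        (mfderivWithin 𝓘(ℝ, ℝ) 𝓘(ℝ, EP) (φ.symm ∘ γ) (Icc 0 1) t (1 : ℝ)) = 0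
      rw [key]
      have h2 : mfderivWithin 𝓘(ℝ, ℝ) 𝓘(ℝ, EP) (φ ∘ (φ.symm ∘ γ)) (Icc 0 1) t (1 : ℝ) =
        mfderiv 𝓘(ℝ, EP) 𝓘(ℝ, EP) φ ((φ.symm ∘ γ) t)
          (mfderivWithin 𝓘(ℝ, ℝ) 𝓘(ℝ, EP) (φ.symm ∘ γ) (Icc 0 1) t (1 : ℝ)) := by
        rw [hc]; rfl
      rw [← h2]
      have h3 : ∀ δ : ℝ → P, δ = γ → A.form (δ t)
          (mfderivWithin 𝓘(ℝ, ℝ) 𝓘(ℝ, EP) δ (Icc 0 1) t (1 : ℝ)) = 0 := by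
        rintro δ rfl
        exact h0
      exact h3 _ he
    · simp only [h1]
      conv_lhs => rw [← hfix]
      simp

theorem hol_eq_of_rel {π : P → B} {Q : B} {A' A : Connection (EG := EG) G (EP := EP) P}
    (h : BasedGaugeRel π Q A' A) {q : P} (hq : π q = Q) (w : ℝ → B) :
    hol π A' w q = hol π A w q := by
  have : IsHolonomy π A' w q = IsHolonomy π A w q :=
    funext fun g => propext (IsHolonomy.of_rel h hq w g)
  unfold hol
  rw [this]

variable (EG G) in
/-- The space `𝓑_{ξ,Q}` of based gauge equivalence classes of smooth connections. -/
def BasedClasses (π : P → B) (Q : B) : Type _ :=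
  Quot (BasedGaugeRel (EG := EG) (G := G) (EP := EP) (P := P) π Q)

/-- The holonomy along `w` with reference to a point `q` over `Q`, as a function of the based
gauge equivalence class. -/
def BasedClasses.hol {π : P → B} {Q : B} (b : BasedClasses EG G (EP := EP) π Q) (w : ℝ → B)
    (q : P) (hq : π q = Q) : G :=
  Quot.lift (fun A => YangMillsWilson.hol π A w q) (fun _ _ h => hol_eq_of_rel h hq w) b

end Bundles

/-! ### The surface: canonical systems of curves, areas, the group `Γ` -/

section Surface

/-- Index set of the generators: `Sum.inl j` stands for `x_j` (and the curve `u_j`), `Sum.inr j`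
for `y_j` (and the curve `v_j`). -/
abbrev Gen (l : ℕ) : Type := Fin l ⊕ Fin l

/-- The relator `r = [x_1, y_1] ⋯ [x_l, y_l]` in the free group `F`. -/
def relator (l : ℕ) : FreeGroup (Gen l) :=
  (List.ofFn fun j : Fin l =>
    FreeGroup.of (Sum.inl j : Gen l) * FreeGroup.of (Sum.inr j) *
      (FreeGroup.of (Sum.inl j))⁻¹ * (FreeGroup.of (Sum.inr j))⁻¹).prod

/-- The normal closure `N` of the relator. -/
def relatorClosure (l : ℕ) : Subgroup (FreeGroup (Gen l)) := Subgroup.normalClosure {relator l}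

instance (l : ℕ) : (relatorClosure l).Normal := by
  unfold relatorClosure
  infer_instance

/-- The group `Γ = F / [F, N]`. -/
abbrev Gam (l : ℕ) : Type :=
  FreeGroup (Gen l) ⧸ ⁅(⊤ : Subgroup (FreeGroup (Gen l))), relatorClosure l⁆

/-- The image of a word in `Γ`. -/
def toGam (l : ℕ) : FreeGroup (Gen l) →* Gam l := QuotientGroup.mk' _

/-- The point of the unit circle at parameter `s ∈ [0,1]` of the side with number `k`
(`0 ≤ k < 4 l`) of the `4 l`-gon. The sides are met in the order `4 l - 1, …, 1, 0` when
the circle is run through counterclockwise from `1`. -/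
def sidePoint (l k : ℕ) (s : ℝ) : ℂ :=
  Circle.exp (2 * Real.pi * ((4 * l - 1 - k + s) / (4 * l)))

variable {S : Type*} [TopologicalSpace S] [ChartedSpace (EuclideanSpace ℝ (Fin 2)) S]

/-- A canonical system `u_1, v_1, …, u_l, v_l` of smooth closed curves based at `Q`, together with
a characteristic map `cell` of the 2-cell that results from cutting the surface along these curves.

Products of loops are read from right to left (`w * w'` is `w'` followed by `w`), the convention for
which holonomy is multiplicative; thus the boundary of the 2-cell, run through counterclockwise,
reads `∏ u_j v_j u_j⁻¹ v_j⁻¹` from right to left. -/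
structure CanonicalSystem (l : ℕ) (Q : S) where
  curve : Gen l → ℝ → S
  curve_smooth : ∀ i, ContMDiffOn 𝓘(ℝ, ℝ) (𝓡 2) ∞ (curve i) (Icc 0 1)
  curve_zero : ∀ i, curve i 0 = Q
  curve_one : ∀ i, curve i 1 = Q
  curve_simple : ∀ i, InjOn (curve i) (Ico 0 1)
  curve_disjoint : ∀ i j, ∀ s ∈ Ioo (0 : ℝ) 1, ∀ t ∈ Ioo (0 : ℝ) 1,
    curve i s = curve j t → i = j
  cell : ℂ → S
  cell_continuous : ContinuousOn cell (Metric.closedBall 0 1)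
  cell_smooth : ContMDiffOn 𝓘(ℝ, ℂ) (𝓡 2) ∞ cell (Metric.ball 0 1)
  cell_injective : InjOn cell (Metric.ball 0 1)
  cell_immersion : ∀ z ∈ Metric.ball (0 : ℂ) 1,
    Function.Injective (mfderiv 𝓘(ℝ, ℂ) (𝓡 2) cell z)
  cell_avoids : ∀ z ∈ Metric.ball (0 : ℂ) 1, ∀ i, ∀ t ∈ Icc (0 : ℝ) 1, cell z ≠ curve i t
  cell_surjective : ∀ b : S, ∃ z ∈ Metric.closedBall (0 : ℂ) 1, cell z = b
  cell_boundary : ∀ (j : Fin l), ∀ s ∈ Icc (0 : ℝ) 1,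
    cell (sidePoint l (4 * j) s) = curve (Sum.inl j) s ∧
    cell (sidePoint l (4 * j + 1) s) = curve (Sum.inr j) s ∧
    cell (sidePoint l (4 * j + 2) s) = curve (Sum.inl j) (1 - s) ∧
    cell (sidePoint l (4 * j + 3) s) = curve (Sum.inr j) (1 - s)

/-- The integral over the open unit disk of the pull-back of the 2-form `vol` under `Δ`. -/
def diskArea (vol : ∀ b : S, TangentSpace (𝓡 2) b →L[ℝ] TangentSpace (𝓡 2) b →L[ℝ] ℝ)
    (Δ : ℂ → S) : ℝ :=
  ∫ z in Metric.ball (0 : ℂ) 1,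
    vol (Δ z) (mfderiv 𝓘(ℝ, ℂ) (𝓡 2) Δ z (1 : ℂ)) (mfderiv 𝓘(ℝ, ℂ) (𝓡 2) Δ z Complex.I)

/-- The boundary loop of a parametrized disk. -/
def boundaryLoop (Δ : ℂ → S) (t : ℝ) : S := Δ (Circle.exp (2 * Real.pi * t))

/-- `Δ` parametrizes a disk in the surface (on the closed unit disk in `ℂ`) whose boundary is a
smooth loop starting at `Q`. -/
structure IsBasedDisk (Q : S) (Δ : ℂ → S) : Prop where
  continuous : ContinuousOn Δ (Metric.closedBall 0 1)
  injective : InjOn Δ (Metric.closedBall 0 1)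
  smooth : ContMDiffOn 𝓘(ℝ, ℂ) (𝓡 2) ∞ Δ (Metric.ball 0 1)
  immersion : ∀ z ∈ Metric.ball (0 : ℂ) 1, Function.Injective (mfderiv 𝓘(ℝ, ℂ) (𝓡 2) Δ z)
  boundary_smooth : ContMDiffOn 𝓘(ℝ, ℝ) (𝓡 2) ∞ (boundaryLoop Δ) (Icc 0 1)
  based : Δ 1 = Q

end Surface

/-! ### The reference circle bundle and its universal covering -/

section Reference

/-- The exterior derivative `dθ(v, w) = (D_v θ)(w) - (D_w θ)(v)` at the point `m` of a smooth
1-form `θ`, computed in the preferred chart at `m`. -/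
def extDerivOneForm {E : Type*} [NormedAddCommGroup E] [NormedSpace ℝ E] {M : Type*}
    [TopologicalSpace M] [ChartedSpace E M] (θ : ∀ m : M, TangentSpace 𝓘(ℝ, E) m →L[ℝ] ℝ) (m : M)
    (v w : TangentSpace 𝓘(ℝ, E) m) : ℝ :=
  let η : E → E →L[ℝ] ℝ := fun y =>
    (θ ((extChartAt 𝓘(ℝ, E) m).symm y)).comp
      (mfderiv 𝓘(ℝ, E) 𝓘(ℝ, E) (extChartAt 𝓘(ℝ, E) m).symm y)
  let D := fderiv ℝ η (extChartAt 𝓘(ℝ, E) m m)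
  D v w - D w v

variable {S : Type*} [TopologicalSpace S] [ChartedSpace (EuclideanSpace ℝ (Fin 2)) S]
  {l : ℕ} {Q : S}

/-- The reference data: a smooth principal `U(1)`-bundle `M → Σ` with a connection form `i θ` whose
curvature form is `-2 π i vol` with `vol` nondegenerate, and of Chern class `1` (that is,
`∫_Σ vol = 1` in the orientation given by `vol`; the complement of the 2-cell is a null set); closed
lifts to `M` of the canonical curves; and a universal covering `Mt → M`. -/
structure ReferenceBundle (c : CanonicalSystem l Q) (EM : Type*) [NormedAddCommGroup EM]
    [NormedSpace ℝ EM] (M : Type*) [TopologicalSpace M] [ChartedSpace EM M]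
    [IsManifold 𝓘(ℝ, EM) ∞ M] [MulAction Circleᵐᵒᵖ M] (Mt : Type*) [TopologicalSpace Mt]
    [SimplyConnectedSpace Mt] where
  proj : M → S
  isPrincipal : IsPrincipalBundle (EG := EuclideanSpace ℝ (Fin 1)) Circle
    (EB := EuclideanSpace ℝ (Fin 2)) (EP := EM) proj
  form : ∀ m : M, TangentSpace 𝓘(ℝ, EM) m →L[ℝ] ℝ
  form_smooth : ContMDiff (𝓘(ℝ, EM).tangent) 𝓘(ℝ, ℝ) ∞
    (fun v : TangentBundle 𝓘(ℝ, EM) M => form v.proj v.snd)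
  form_vertical : ∀ m : M, form (MulOpposite.op (Circle.exp 0) • m)
    (mfderiv 𝓘(ℝ, ℝ) 𝓘(ℝ, EM) (fun t : ℝ => MulOpposite.op (Circle.exp t) • m) 0 (1 : ℝ)) = 1
  form_invariant : ∀ (z : Circle) (m : M) (v : TangentSpace 𝓘(ℝ, EM) m),
    form (MulOpposite.op z • m)
      (mfderiv 𝓘(ℝ, EM) 𝓘(ℝ, EM) (fun m' : M => MulOpposite.op z • m') m v) = form m v
  vol : ∀ b : S, TangentSpace (𝓡 2) b →L[ℝ] TangentSpace (𝓡 2) b →L[ℝ] ℝ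
  vol_nondegenerate : ∀ (b : S) (v : TangentSpace (𝓡 2) b), v ≠ 0 → ∃ w, vol b v w ≠ 0
  curvature : ∀ (m : M) (v w : TangentSpace 𝓘(ℝ, EM) m),
    extDerivOneForm form m v w = -(2 * Real.pi) *
      vol (proj m) (mfderiv 𝓘(ℝ, EM) (𝓡 2) proj m v) (mfderiv 𝓘(ℝ, EM) (𝓡 2) proj m w)
  cell_positive : ∀ z ∈ Metric.ball (0 : ℂ) 1, 0 < vol (c.cell z)
    (mfderiv 𝓘(ℝ, ℂ) (𝓡 2) c.cell z (1 : ℂ)) (mfderiv 𝓘(ℝ, ℂ) (𝓡 2) c.cell z Complex.I)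
  chern_one : diskArea vol c.cell = 1
  base : M
  proj_base : proj base = Q
  lift : Gen l → ℝ → M
  lift_continuous : ∀ i, ContinuousOn (lift i) (Icc 0 1)
  lift_zero : ∀ i, lift i 0 = base
  lift_one : ∀ i, lift i 1 = base
  proj_lift : ∀ i, ∀ t ∈ Icc (0 : ℝ) 1, proj (lift i t) = c.curve i t
  cover : Mt → M
  cover_isCovering : IsCoveringMap cover
  coverBase : Mt
  cover_base : cover coverBase = base

variable {c : CanonicalSystem l Q} {EM : Type*} [NormedAddCommGroup EM]
  [NormedSpace ℝ EM] {M : Type*} [TopologicalSpace M] [ChartedSpace EM M]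
  [IsManifold 𝓘(ℝ, EM) ∞ M] [MulAction Circleᵐᵒᵖ M] {Mt : Type*} [TopologicalSpace Mt]
  [SimplyConnectedSpace Mt]
  {EG : Type*} [NormedAddCommGroup EG] [NormedSpace ℝ EG]
  {G : Type*} [TopologicalSpace G] [ChartedSpace EG G] [Group G]
  {P : Type*} [TopologicalSpace P] [MulAction Gᵐᵒᵖ P]

/-- The deck transformation `D` of `Mt → M` is the action `m ↦ m · x_i` of the generator `x_i` of
`Γ ≅ π_1(M)`: it takes the base point to the end point of the lift of the `i`-th closed curve. -/
def ReferenceBundle.IsDeck (R : ReferenceBundle c EM M Mt) (i : Gen l) (D : Mt ≃ₜ Mt) : Prop :=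
  (∀ m, R.cover (D m) = R.cover m) ∧
  ∃ γ : ℝ → Mt, ContinuousOn γ (Icc 0 1) ∧ γ 0 = R.coverBase ∧ γ 1 = D R.coverBase ∧
    ∀ t ∈ Icc (0 : ℝ) 1, R.cover (γ t) = R.lift i t

/-- `γ` is an orbit `t ↦ m · t` of the `ℝ`-action on `Mt` that lifts the `U(1)`-action on `M` along
`t ↦ e^{it}`. -/
def ReferenceBundle.IsFlowLine (R : ReferenceBundle c EM M Mt) (γ : ℝ → Mt) : Prop :=
  Continuous γ ∧ ∀ t, R.cover (γ t) = MulOpposite.op (Circle.exp t) • R.cover (γ 0)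

/-- The identifications `(m · γ, g) ∼ (m, χ(γ) g)` on `Mt × G`, for `γ` in a generating set of
`Γ_ℝ`: the generators of `Γ`, and the elements `t [r]` of the central subgroup `ℝ` of `Γ_ℝ`, which
act on `Mt` as `2 π t ∈ ℝ`; there, `χ` is extended to `Γ_ℝ` by `χ(t [r]) = exp (t X)`. -/
inductive ReferenceBundle.AssocRel (R : ReferenceBundle c EM M Mt)
    (X : GroupLieAlgebra 𝓘(ℝ, EG) G) (χ : Gam l →* G) : Mt × G → Mt × G → Prop
  | deck (i : Gen l) (D : Mt ≃ₜ Mt) (hD : R.IsDeck i D) (m : Mt) (g : G) :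
      AssocRel R X χ (D m, g) (m, χ (toGam l (FreeGroup.of i)) * g)
  | flow (γ : ℝ → Mt) (hγ : R.IsFlowLine γ) (t : ℝ) (g : G) :
      AssocRel R X χ (γ (2 * Real.pi * t), g) (γ 0, lieExp (t • X) * g)

/-- The total space `Mt ×_χ G` of the principal `G`-bundle `ξ_χ`, with the quotient topology. -/
abbrev ReferenceBundle.Assoc (R : ReferenceBundle c EM M Mt) (X : GroupLieAlgebra 𝓘(ℝ, EG) G)
    (χ : Gam l →* G) : Type _ :=
  Quot (R.AssocRel X χ)

/-- The principal bundles `ξ_χ` and `π : P → Σ` have the same topological type: there is a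
`G`-equivariant homeomorphism `Mt ×_χ G → P` over the identity of `Σ`. -/
def ReferenceBundle.AssocIso (R : ReferenceBundle c EM M Mt) (π : P → S)
    (X : GroupLieAlgebra 𝓘(ℝ, EG) G) (χ : Gam l →* G) : Prop :=
  ∃ f : R.Assoc X χ ≃ₜ P,
    (∀ m g, π (f (Quot.mk _ (m, g))) = R.proj (R.cover m)) ∧
    ∀ m g h, f (Quot.mk _ (m, g * h)) = MulOpposite.op h • f (Quot.mk _ (m, g))

/-- `X ∈ 𝔥` is the topological characteristic class `X_ξ` of `π : P → Σ`: for `S = [G, G]`, the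
principal bundle `P/S` is obtained from `M` by extension of the structure group along
`e^{2 π i t} ↦ exp (t X)`, as witnessed by an equivariant continuous map `M → P/S` over `Σ`. -/
def ReferenceBundle.IsCharClass (R : ReferenceBundle c EM M Mt) (π : P → S)
    (X : GroupLieAlgebra 𝓘(ℝ, EG) G) : Prop :=
  IsCentralVector X ∧
  ∃ μ : M → Quotient (MulAction.orbitRel (commutator G).op P), Continuous μ ∧
    ∀ (m : M) (p : P), μ m = Quotient.mk _ p → π p = R.proj m ∧
      ∀ t : ℝ, μ (MulOpposite.op (Circle.exp (2 * Real.pi * t)) • m) =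
        Quotient.mk _ (MulOpposite.op (lieExp (t • X)) • p)

/-- The space `Hom_{X_ξ}(Γ, G)_ξ`, as a subspace of `Hom(F, G) ≅ G^{2l}` by evaluation at the
generators: the homomorphisms `χ : Γ → G` with `χ [r] = exp X` for which `ξ_χ` is isomorphic to
`ξ`. -/
def homComponent (R : ReferenceBundle c EM M Mt) (π : P → S) (X : GroupLieAlgebra 𝓘(ℝ, EG) G) :
    Set (Gen l → G) :=
  {a | ∃ χ : Gam l →* G, (∀ i, χ (toGam l (FreeGroup.of i)) = a i) ∧
    χ (toGam l (relator l)) = lieExp X ∧ R.AssocIso π X χ}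

end Reference

/-! ### The Wilson loop mapping and the constraints -/

section Wilson

variable {S : Type*} [TopologicalSpace S] [ChartedSpace (EuclideanSpace ℝ (Fin 2)) S]
  {l : ℕ} {Q : S}
  {EG : Type*} [NormedAddCommGroup EG] [NormedSpace ℝ EG]
  {G : Type*} [TopologicalSpace G] [ChartedSpace EG G] [Group G]
  {EP : Type*} [NormedAddCommGroup EP] [NormedSpace ℝ EP]
  {P : Type*} [TopologicalSpace P] [ChartedSpace EP P] [MulAction Gᵐᵒᵖ P]
  [IsManifold 𝓘(ℝ, EP) ∞ P] {π : P → S}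

/-- The Wilson loop mapping `ρ_♭ : 𝓑_{ξ,Q} → G^{2l} ≅ Hom(F, G)` relative to the canonical system
`c` and the base point `q` of `P`. -/
def wilson (c : CanonicalSystem l Q) (q : P) (hq : π q = Q)
    (b : BasedClasses EG G (EP := EP) π Q) : Gen l → G :=
  fun i => b.hol (c.curve i) q hq

/-- The constraint attached to a disk `Δ` whose boundary loop `w` starts at `Q`:
`[A] ↦ Hol_{w,q}(A) · exp (a_Δ X)⁻¹`, where `a_Δ` is the area of `Δ`, oriented by `w`. -/
def constraint (vol : ∀ b : S, TangentSpace (𝓡 2) b →L[ℝ] TangentSpace (𝓡 2) b →L[ℝ] ℝ)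
    (X : GroupLieAlgebra 𝓘(ℝ, EG) G) (Δ : ℂ → S) (q : P) (hq : π q = Q)
    (b : BasedClasses EG G (EP := EP) π Q) : G :=
  b.hol (boundaryLoop Δ) q hq * (lieExp (diskArea vol Δ • X))⁻¹

/-- The subspace `𝓒𝓨𝓜_{ξ,Q}` of `𝓑_{ξ,Q}` cut out by all constraints. -/
def CYM (vol : ∀ b : S, TangentSpace (𝓡 2) b →L[ℝ] TangentSpace (𝓡 2) b →L[ℝ] ℝ)
    (X : GroupLieAlgebra 𝓘(ℝ, EG) G) (q : P) (hq : π q = Q) :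
    Set (BasedClasses EG G (EP := EP) π Q) :=
  {b | ∀ Δ : ℂ → S, IsBasedDisk Q Δ → constraint vol X Δ q hq b = 1}

end Wilson

/-! ### Conjugation and orbit type stratifications -/

section Strata

variable {ι : Type*} [Fintype ι] {EG : Type*} [NormedAddCommGroup EG] [NormedSpace ℝ EG]
  {G : Type*} [TopologicalSpace G] [ChartedSpace EG G] [Group G]

/-- The conjugation action of `G` on `G^ι`. -/
def conjTuple (x : G) (a : ι → G) : ι → G := fun i => x * a i * x⁻¹

/-- The points of `H ⊆ G^ι` whose stabilizer under conjugation is conjugate to that of `a`. -/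
def orbitTypePiece (H : Set (ι → G)) (a : ι → G) : Set (ι → G) :=
  {b | b ∈ H ∧ ∃ g : G, ∀ h : G, conjTuple h a = a ↔ conjTuple (g * h * g⁻¹) b = b}

/-- `T` is a stratum of the `G`-orbit (type) stratification of `H`: a connected component of an
orbit type subspace. -/
def IsStratum (H T : Set (ι → G)) : Prop :=
  ∃ a ∈ H, T = connectedComponentIn (orbitTypePiece H a) a

variable (EG) in
/-- The map `f : H → G^ι` is smooth on `T ⊆ H`: locally it is the restriction to `T` of a smooth map
between open subsets of the manifold `G^ι`. -/
def IsSmoothAlong {H : Set (ι → G)} (T : Set (ι → G)) (f : H → ι → G) : Prop :=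
  ∀ p ∈ T, ∃ U : Set (ι → G), IsOpen U ∧ p ∈ U ∧ ∃ F : (ι → G) → (ι → G),
    ContMDiffOn (ModelWithCorners.pi fun _ : ι => 𝓘(ℝ, EG))
      (ModelWithCorners.pi fun _ : ι => 𝓘(ℝ, EG)) ∞ F U ∧
    ∀ b : H, (b : ι → G) ∈ T → (b : ι → G) ∈ U → F b = f b

variable (EG) in
/-- The homeomorphism `κ` is an isomorphism of stratified spaces: it and its inverse take strata
onto strata and are smooth on each stratum. -/
structure IsStratifiedIso {H H' : Set (ι → G)} (κ : H ≃ₜ H') : Prop where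
  image_stratum : ∀ T, IsStratum H T → IsStratum H' {b | ∃ a : H, (a : ι → G) ∈ T ∧ b = κ a}
  symm_image_stratum : ∀ T, IsStratum H' T →
    IsStratum H {b | ∃ a : H', (a : ι → G) ∈ T ∧ b = κ.symm a}
  smooth : ∀ T, IsStratum H T → IsSmoothAlong EG T (fun a => (κ a : ι → G))
  symm_smooth : ∀ T, IsStratum H' T → IsSmoothAlong EG T (fun a => (κ.symm a : ι → G))

end Strata

end YangMillsWilson

end

open YangMillsWilson

namespace YangMillsWilson

/-! Everything rests on one formula: if the horizontal lift of `w` from `q` ends at `q · g`, its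
translate by `x` is horizontal, starts at `q · x` and ends at `q · g · x = (q · x) · (x⁻¹ g x)`.
Hence `Hol_{w,q} = x Hol_{w,q·x} x⁻¹` for every loop, and applying it to the canonical curves gives
the relation between the two Wilson loop mappings.

Since `hol` is defined by choice, the formula needs horizontal lifts to be unique
(`IsHorizontalLift.apply_one_eq`). Two lifts differ locally by a curve `k` in `G`, and comparing
connection forms shows that `k` has zero velocity. Existence of lifts plays no role: where there is
none, the default value `1` is its own conjugate (`hol_eq_conj`).

The constraints do not depend on the reference point because `exp (a X)` is central, hence fixed by
conjugation. For the same reason conjugation by `x` preserves the representation space: the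
condition on `[r]` survives, and left translation by `x⁻¹` in the fibre identifies the bundles of `x
χ x⁻¹` and `χ` (`homComponent_conjTuple`). On an invariant subspace, conjugation is the restriction
of a diffeomorphism of `G^ι` that replaces stabilizers by conjugate ones, so it permutes the strata
(`isStratifiedIso_conjOn`). -/

/-- A map into a finite power of a manifold is smooth if its components factor through smooth maps
of the corresponding coordinates. -/
theorem contMDiff_piMap {ι : Type*} [Fintype ι] {EG : Type*} [NormedAddCommGroup EG]
    [NormedSpace ℝ EG] {G : Type*} [TopologicalSpace G] [ChartedSpace EG G] {f : ι → G → G}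
    (hf : ∀ i, ContMDiff 𝓘(ℝ, EG) 𝓘(ℝ, EG) ∞ (f i)) :
    ContMDiff (ModelWithCorners.pi fun _ : ι => 𝓘(ℝ, EG))
      (ModelWithCorners.pi fun _ : ι => 𝓘(ℝ, EG)) ∞ (fun (a : ι → G) i => f i (a i)) := by
  intro a
  rw [contMDiffAt_iff]
  refine ⟨(continuous_pi fun i => (hf i).continuous.comp (continuous_apply i)).continuousAt, ?_⟩
  -- The preferred chart of the power is the product of the charts of the factors, so the `i`-th
  -- component is the chart expression of `f i` composed with the `i`-th projection.
  refine contDiffWithinAt_pi.2 fun i => ?_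
  have h := (contMDiffAt_iff.1 (hf i (a i))).2
  have hp : ContDiffWithinAt ℝ ∞ (fun y : ι → EG => y i)
      (range (ModelWithCorners.pi fun _ : ι => 𝓘(ℝ, EG)))
      (extChartAt (ModelWithCorners.pi fun _ : ι => 𝓘(ℝ, EG)) a a) :=
    (contDiff_apply ℝ EG i).contDiffWithinAt
  exact ContDiffWithinAt.comp (g := extChartAt 𝓘(ℝ, EG) (f i (a i)) ∘ f i ∘
    (extChartAt 𝓘(ℝ, EG) (a i)).symm) (t := range 𝓘(ℝ, EG)) _ h hp fun y _ => ⟨y i, rfl⟩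

/-! ### Simultaneous conjugation and the stratification of invariant subspaces -/

section Conjugation

variable {ι : Type*} {G : Type*} [Group G]

theorem conjTuple_mul (x y : G) (a : ι → G) :
    conjTuple (x * y) a = conjTuple x (conjTuple y a) := by
  funext i
  simp only [conjTuple]
  group

theorem conjTuple_inv_conjTuple (x : G) (a : ι → G) : conjTuple x⁻¹ (conjTuple x a) = a := by
  funext i
  simp only [conjTuple]
  group

theorem conjTuple_conjTuple_inv (x : G) (a : ι → G) : conjTuple x (conjTuple x⁻¹ a) = a := by
  simpa using conjTuple_inv_conjTuple x⁻¹ a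

theorem orbitTypePiece_conjTuple {H : Set (ι → G)} (x : G) (a : ι → G) :
    orbitTypePiece H (conjTuple x a) = orbitTypePiece H a := by
  have key : ∀ (y : G) (c : ι → G), orbitTypePiece H c ⊆ orbitTypePiece H (conjTuple y c) := by
    rintro y c b ⟨hb, g, hg⟩
    -- The stabilizer of `conjTuple y c` is `y Stab(c) y⁻¹`, so the conjugating element changes by
    -- `y⁻¹` on the right.
    refine ⟨hb, g * y⁻¹, fun h => ?_⟩
    have h1 : conjTuple h (conjTuple y c) = conjTuple y c ↔ conjTuple (y⁻¹ * h * y) c = c := by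
      rw [conjTuple_mul, conjTuple_mul]
      constructor
      · intro e
        rw [e, conjTuple_inv_conjTuple]
      · intro e
        conv_rhs => rw [← e]
        rw [conjTuple_conjTuple_inv]
    rw [h1, hg]
    have h2 : g * (y⁻¹ * h * y) * g⁻¹ = g * y⁻¹ * h * (g * y⁻¹)⁻¹ := by group
    rw [h2]
  refine Subset.antisymm ?_ (key x a)
  simpa only [conjTuple_inv_conjTuple] using key x⁻¹ (conjTuple x a)

theorem image_orbitTypePiece {H : Set (ι → G)} (hH : ∀ y : G, ∀ a ∈ H, conjTuple y a ∈ H) (x : G)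
    (a : ι → G) : conjTuple x '' orbitTypePiece H a = orbitTypePiece H a := by
  have key : ∀ (y : G) (b : ι → G), b ∈ orbitTypePiece H a → conjTuple y b ∈ orbitTypePiece H a := by
    rintro y b ⟨hb, g, hg⟩
    -- Here the point `b` moves instead of the reference tuple: `Stab(y · b) = y Stab(b) y⁻¹`, so
    -- the conjugating element picks up `y` on the left.
    refine ⟨hH y b hb, y * g, fun h => ?_⟩
    rw [hg]
    have h2 : y * g * h * (y * g)⁻¹ = y * ((g * h * g⁻¹) * y⁻¹) := by group
    rw [h2, conjTuple_mul y, conjTuple_mul _ y⁻¹, conjTuple_inv_conjTuple]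
    constructor
    · intro e
      rw [e]
    · intro e
      simpa only [conjTuple_inv_conjTuple] using congrArg (conjTuple y⁻¹) e
  refine Subset.antisymm (image_subset_iff.2 fun b hb => key x b hb) fun b hb => ?_
  exact ⟨conjTuple x⁻¹ b, key x⁻¹ b hb, conjTuple_conjTuple_inv x b⟩

variable [TopologicalSpace G]

/-- Simultaneous conjugation by `x` as a homeomorphism of `G^ι`. -/
def conjHomeomorph [IsTopologicalGroup G] (ι : Type*) (x : G) : (ι → G) ≃ₜ (ι → G) where
  toFun := conjTuple x
  invFun := conjTuple x⁻¹
  left_inv := conjTuple_inv_conjTuple x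
  right_inv := conjTuple_conjTuple_inv x
  continuous_toFun := by unfold conjTuple; fun_prop
  continuous_invFun := by unfold conjTuple; fun_prop

theorem IsStratum.subset {H T : Set (ι → G)} (hT : IsStratum H T) : T ⊆ H := by
  obtain ⟨a, -, rfl⟩ := hT
  exact fun b hb => (connectedComponentIn_subset _ _ hb).1

/-- A homeomorphism carries connected components to connected components. The orbit type piece is
mapped onto itself, and `conjTuple x a` determines the same piece as `a`, so the image is again a
component of that piece. -/
theorem IsStratum.image_conjTuple [IsTopologicalGroup G] {H T : Set (ι → G)}
    (hH : ∀ y : G, ∀ a ∈ H, conjTuple y a ∈ H) (hT : IsStratum H T) (x : G) :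
    IsStratum H (conjTuple x '' T) := by
  obtain ⟨a, ha, rfl⟩ := hT
  refine ⟨conjTuple x a, hH x a ha, ?_⟩
  have hmem : a ∈ orbitTypePiece H a := ⟨ha, 1, fun h => by simp⟩
  have := (conjHomeomorph ι x).image_connectedComponentIn hmem
  change conjTuple x '' _ = connectedComponentIn (conjTuple x '' _) (conjTuple x a) at this
  rw [this, image_orbitTypePiece hH, orbitTypePiece_conjTuple]

variable {EG : Type*} [NormedAddCommGroup EG] [NormedSpace ℝ EG] [ChartedSpace EG G]

theorem contMDiff_conjTuple [Fintype ι] [LieGroup 𝓘(ℝ, EG) ∞ G] (x : G) :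
    ContMDiff (ModelWithCorners.pi fun _ : ι => 𝓘(ℝ, EG))
      (ModelWithCorners.pi fun _ : ι => 𝓘(ℝ, EG)) ∞ (conjTuple (ι := ι) x) :=
  contMDiff_piMap fun _ => (contMDiff_mul_right (a := x⁻¹)).comp (contMDiff_mul_left (a := x))

/-- Conjugation by `x` as a self-homeomorphism of a conjugation invariant subspace of `G^ι`. -/
def conjOn [IsTopologicalGroup G] {H : Set (ι → G)} (hH : ∀ y : G, ∀ a ∈ H, conjTuple y a ∈ H)
    (x : G) : H ≃ₜ H :=
  (conjHomeomorph ι x).subtype fun a =>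
    ⟨hH x a, fun h => by simpa only [conjHomeomorph, Homeomorph.homeomorph_mk_coe, Equiv.coe_fn_mk,
      conjTuple_inv_conjTuple] using hH x⁻¹ _ h⟩

theorem coe_conjOn [IsTopologicalGroup G] {H : Set (ι → G)}
    (hH : ∀ y : G, ∀ a ∈ H, conjTuple y a ∈ H) (x : G) (a : H) :
    (conjOn hH x a : ι → G) = conjTuple x a := rfl

theorem coe_conjOn_symm [IsTopologicalGroup G] {H : Set (ι → G)}
    (hH : ∀ y : G, ∀ a ∈ H, conjTuple y a ∈ H) (x : G) (a : H) :
    ((conjOn hH x).symm a : ι → G) = conjTuple x⁻¹ a := rfl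

-- Smoothness on strata costs nothing: conjugation is smooth on all of `G^ι`, so it serves as its
-- own local extension. The inverse is conjugation by `x⁻¹`, which makes the two halves symmetric.
variable (EG) in
theorem isStratifiedIso_conjOn [Fintype ι] [IsTopologicalGroup G] [LieGroup 𝓘(ℝ, EG) ∞ G]
    {H : Set (ι → G)} (hH : ∀ y : G, ∀ a ∈ H, conjTuple y a ∈ H) (x : G) :
    IsStratifiedIso EG (conjOn hH x) := by
  have himage : ∀ (y : G) (T : Set (ι → G)), IsStratum H T →
      {b | ∃ a : H, (a : ι → G) ∈ T ∧ b = conjTuple y a} = conjTuple y '' T := by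
    intro y T hT
    ext b
    constructor
    · rintro ⟨a, ha, rfl⟩
      exact mem_image_of_mem _ ha
    · rintro ⟨a, ha, rfl⟩
      exact ⟨⟨a, hT.subset ha⟩, ha, rfl⟩
  have hsmooth : ∀ (y : G) (T : Set (ι → G)),
      IsSmoothAlong EG T (fun a : H => conjTuple y (a : ι → G)) := fun y T p _ =>
    ⟨univ, isOpen_univ, mem_univ p, conjTuple y, (contMDiff_conjTuple y).contMDiffOn,
      fun _ _ _ => rfl⟩
  constructor
  · intro T hT
    simp only [coe_conjOn]
    rw [himage x T hT]
    exact hT.image_conjTuple hH x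
  · intro T hT
    simp only [coe_conjOn_symm]
    rw [himage x⁻¹ T hT]
    exact hT.image_conjTuple hH x⁻¹
  · exact fun T _ => hsmooth x T
  · exact fun T _ => hsmooth x⁻¹ T

end Conjugation

/-! ### Conjugation invariance of the representation space -/

section Representations

variable {S : Type*} [TopologicalSpace S] [ChartedSpace (EuclideanSpace ℝ (Fin 2)) S]
  {l : ℕ} {Q : S} {c : CanonicalSystem l Q} {EM : Type*} [NormedAddCommGroup EM]
  [NormedSpace ℝ EM] {M : Type*} [TopologicalSpace M] [ChartedSpace EM M]
  [IsManifold 𝓘(ℝ, EM) ∞ M] [MulAction Circleᵐᵒᵖ M] {Mt : Type*} [TopologicalSpace Mt]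
  [SimplyConnectedSpace Mt]
  {EG : Type*} [NormedAddCommGroup EG] [NormedSpace ℝ EG]
  {G : Type*} [TopologicalSpace G] [ChartedSpace EG G] [Group G]
  {P : Type*} [TopologicalSpace P] [MulAction Gᵐᵒᵖ P]

theorem mul_lieExp_mul_inv {X : GroupLieAlgebra 𝓘(ℝ, EG) G} (hX : IsCentralVector X) (t : ℝ)
    (x : G) : x * lieExp (t • X) * x⁻¹ = lieExp (t • X) := by
  rw [Subgroup.mem_center_iff.1 (hX t) x, mul_inv_cancel_right]

/-- Left multiplication by `x⁻¹` turns `x χ(γ) x⁻¹ g` into `χ(γ) (x⁻¹ g)`, which settles the deck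
identifications. For the flow identifications it must commute with `exp (t X)`; this is where
centrality of `X` enters. -/
theorem ReferenceBundle.AssocRel.conj {R : ReferenceBundle c EM M Mt}
    {X : GroupLieAlgebra 𝓘(ℝ, EG) G} (hX : IsCentralVector X) {χ χ' : Gam l →* G} {x : G}
    (hχ : ∀ γ, χ' γ = x * χ γ * x⁻¹) {p p' : Mt × G} (h : R.AssocRel X χ' p p') :
    R.AssocRel X χ (p.1, x⁻¹ * p.2) (p'.1, x⁻¹ * p'.2) := by
  cases h with
  | deck i D hD m g =>
    have e : x⁻¹ * (χ' (toGam l (FreeGroup.of i)) * g) =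
        χ (toGam l (FreeGroup.of i)) * (x⁻¹ * g) := by
      rw [hχ]
      group
    simp only [e]
    exact .deck i D hD m _
  | flow γ hγ t g =>
    have e : x⁻¹ * (lieExp (t • X) * g) = lieExp (t • X) * (x⁻¹ * g) := by
      rw [← mul_assoc, Subgroup.mem_center_iff.1 (hX t) x⁻¹, mul_assoc]
    simp only [e]
    exact .flow γ hγ t _

/-- The bundles associated with conjugate homomorphisms are homeomorphic. -/
def ReferenceBundle.assocConj [IsTopologicalGroup G] (R : ReferenceBundle c EM M Mt)
    {X : GroupLieAlgebra 𝓘(ℝ, EG) G} (hX : IsCentralVector X) {χ χ' : Gam l →* G} {x : G}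
    (hχ : ∀ γ, χ' γ = x * χ γ * x⁻¹) : R.Assoc X χ' ≃ₜ R.Assoc X χ where
  toFun := Quot.map (fun p => (p.1, x⁻¹ * p.2)) fun _ _ h => h.conj hX hχ
  invFun := Quot.map (fun p => (p.1, x * p.2)) fun _ _ h => by
    -- The inverse comes from the same lemma with `χ`, `χ'` exchanged and `x⁻¹` in place of `x`.
    have hχ' : ∀ γ, χ γ = x⁻¹ * χ' γ * x⁻¹⁻¹ := fun γ => by
      rw [hχ]
      group
    simpa only [inv_inv] using h.conj hX hχ'
  left_inv := by
    rintro ⟨m, g⟩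
    simp [Quot.map]
  right_inv := by
    rintro ⟨m, g⟩
    simp [Quot.map]
  continuous_toFun := continuous_quot_lift _ (continuous_quot_mk.comp (by fun_prop))
  continuous_invFun := continuous_quot_lift _ (continuous_quot_mk.comp (by fun_prop))

theorem homComponent_conjTuple [IsTopologicalGroup G] (R : ReferenceBundle c EM M Mt) (π : P → S)
    {X : GroupLieAlgebra 𝓘(ℝ, EG) G} (hX : IsCentralVector X) (x : G) (a : Gen l → G)
    (ha : a ∈ homComponent R π X) : conjTuple x a ∈ homComponent R π X := by
  obtain ⟨χ, hgen, hrel, f, hf1, hf2⟩ := ha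
  have hχ : ∀ γ, ((MulAut.conj x).toMonoidHom.comp χ) γ = x * χ γ * x⁻¹ := fun γ => rfl
  refine ⟨(MulAut.conj x).toMonoidHom.comp χ, fun i => ?_, ?_,
    (R.assocConj hX hχ).trans f, fun m g => hf1 m (x⁻¹ * g), fun m g h => ?_⟩
  · rw [hχ, hgen, conjTuple]
  · rw [hχ, hrel]
    simpa only [one_smul] using mul_lieExp_mul_inv hX 1 x
  -- Equivariance is kept because left translation by `x⁻¹` commutes with right multiplication by
  -- `h`.
  · have := hf2 m (x⁻¹ * g) h
    rw [mul_assoc] at this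
    exact this

end Representations


/-! ### Horizontal lifts -/

section HorizontalLifts

open Filter Topology

/-- A curve in a manifold with vanishing derivative is locally constant. -/
theorem eventually_eq_of_mfderivWithin_eq_zero {E : Type*} [NormedAddCommGroup E]
    [NormedSpace ℝ E] {N : Type*} [TopologicalSpace N] [ChartedSpace E N]
    [IsManifold 𝓘(ℝ, E) ∞ N] {s : Set ℝ} (hs : Convex ℝ s) {k : ℝ → N}
    {t₀ : ℝ} (ht₀ : t₀ ∈ s)
    (hk : ∀ᶠ t in 𝓝[s] t₀, MDifferentiableWithinAt 𝓘(ℝ, ℝ) 𝓘(ℝ, E) k s t ∧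
      mfderivWithin 𝓘(ℝ, ℝ) 𝓘(ℝ, E) k s t (1 : ℝ) = 0) :
    ∀ᶠ t in 𝓝[s] t₀, k t = k t₀ := by
  have hk₀ := hk.self_of_nhdsWithin ht₀
  have hsrc : ∀ᶠ t in 𝓝[s] t₀, k t ∈ (chartAt E (k t₀)).source :=
    hk₀.1.continuousWithinAt.eventually
      ((chartAt E (k t₀)).open_source.mem_nhds (mem_chart_source E (k t₀)))
  obtain ⟨ε, hε, hball⟩ := Metric.mem_nhdsWithin_iff.1 (hk.and hsrc)
  have hconv : Convex ℝ (Metric.ball t₀ ε ∩ s) := (convex_ball t₀ ε).inter hs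
  have hd : ∀ t ∈ Metric.ball t₀ ε ∩ s,
      HasFDerivWithinAt (extChartAt 𝓘(ℝ, E) (k t₀) ∘ k) (0 : ℝ →L[ℝ] E) (Metric.ball t₀ ε ∩ s) t := by
    intro t ht
    obtain ⟨⟨h1, h2⟩, h3⟩ := hball ht
    have hchart : MDifferentiableAt 𝓘(ℝ, E) 𝓘(ℝ, E) (extChartAt 𝓘(ℝ, E) (k t₀)) (k t) :=
      mdifferentiableAt_extChartAt h3
    have hc := hchart.hasMFDerivAt.comp_hasMFDerivWithinAt t h1.hasMFDerivWithinAt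
    have h0 : mfderivWithin 𝓘(ℝ, ℝ) 𝓘(ℝ, E) k s t = 0 := by
      refine ContinuousLinearMap.ext_ring ?_
      exact h2
    rw [h0, ContinuousLinearMap.comp_zero] at hc
    exact (hasMFDerivWithinAt_iff_hasFDerivWithinAt.1 hc).mono inter_subset_right
  have hmem : ∀ᶠ t in 𝓝[s] t₀, t ∈ Metric.ball t₀ ε ∩ s :=
    (inter_mem_nhdsWithin s (Metric.ball_mem_nhds t₀ hε)) |> fun h => by
      rwa [inter_comm] at h
  filter_upwards [hmem] with t ht
  have h0 : t₀ ∈ Metric.ball t₀ ε ∩ s := ⟨Metric.mem_ball_self hε, ht₀⟩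
  -- Mean value inequality with bound `0`, in the chart at `k t₀`; injectivity of that chart then
  -- returns the equality to the manifold.
  have he := hconv.norm_image_sub_le_of_norm_hasFDerivWithin_le (C := 0) hd
    (fun _ _ => by simp) h0 ht
  rw [zero_mul, norm_le_zero_iff, sub_eq_zero] at he
  have hin : ∀ u ∈ Metric.ball t₀ ε ∩ s, k u ∈ (extChartAt 𝓘(ℝ, E) (k t₀)).source := fun u hu => by
    rw [extChartAt_source]
    exact (hball hu).2
  exact (extChartAt 𝓘(ℝ, E) (k t₀)).injOn (hin t ht) (hin t₀ h0) he

variable {EG : Type*} [NormedAddCommGroup EG] [NormedSpace ℝ EG]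
  {G : Type*} [TopologicalSpace G] [ChartedSpace EG G] [Group G]
  {EB : Type*} [NormedAddCommGroup EB] [NormedSpace ℝ EB]
  {B : Type*} [TopologicalSpace B] [ChartedSpace EB B]
  {EP : Type*} [NormedAddCommGroup EP] [NormedSpace ℝ EP]
  {P : Type*} [TopologicalSpace P] [ChartedSpace EP P] [MulAction Gᵐᵒᵖ P] {π : P → B}

/-- The action is free because a local trivialization turns it into right multiplication on `G`. -/
theorem IsPrincipalBundle.smul_left_injective
    (hξ : IsPrincipalBundle (EG := EG) G (EB := EB) (EP := EP) π) (p : P) {g h : G}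
    (hgh : MulOpposite.op g • p = MulOpposite.op h • p) : g = h := by
  obtain ⟨U, -, hU, e, hs, -, -, -, he⟩ := hξ.locally_trivial (π p)
  have hp : p ∈ e.source := by rw [hs]; exact hU
  have h1 := (he p hp g).2.2
  rw [hgh, (he p hp h).2.2] at h1
  exact (mul_left_cancel (Prod.ext_iff.1 h1).2).symm

theorem IsPrincipalBundle.contMDiff_smul
    (hξ : IsPrincipalBundle (EG := EG) G (EB := EB) (EP := EP) π) (g : G) :
    ContMDiff 𝓘(ℝ, EP) 𝓘(ℝ, EP) ∞ (fun p : P => MulOpposite.op g • p) :=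
  hξ.smooth_action.comp (contMDiff_id.prodMk contMDiff_const)

/-- Two curves over the same base curve differ, locally, by a differentiable curve in the group. -/
theorem IsPrincipalBundle.exists_translation [LieGroup 𝓘(ℝ, EG) ∞ G]
    (hξ : IsPrincipalBundle (EG := EG) G (EB := EB) (EP := EP) π) {s : Set ℝ} {γ₁ γ₂ : ℝ → P}
    (h₁ : ContMDiffOn 𝓘(ℝ, ℝ) 𝓘(ℝ, EP) ∞ γ₁ s) (h₂ : ContMDiffOn 𝓘(ℝ, ℝ) 𝓘(ℝ, EP) ∞ γ₂ s)
    (hπ : ∀ t ∈ s, π (γ₁ t) = π (γ₂ t)) {t₀ : ℝ} (ht₀ : t₀ ∈ s) :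
    ∃ k : ℝ → G, ∀ᶠ t in 𝓝[s] t₀, MDifferentiableWithinAt 𝓘(ℝ, ℝ) 𝓘(ℝ, EG) k s t ∧
      γ₂ t = MulOpposite.op (k t) • γ₁ t := by
  obtain ⟨U, hUo, hU, e, hs, -, hsm, -, he⟩ := hξ.locally_trivial (π (γ₁ t₀))
  have hmem : ∀ᶠ t in 𝓝[s] t₀, t ∈ s ∧ γ₁ t ∈ e.source := by
    refine eventually_mem_nhdsWithin.and ?_
    refine (h₁.continuousOn t₀ ht₀).eventually (e.open_source.mem_nhds ?_)
    rw [hs]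
    exact hU
  -- In the trivialization `G` multiplies fibre coordinates on the right, which forces this
  -- quotient.
  refine ⟨fun t => (e (γ₁ t)).2⁻¹ * (e (γ₂ t)).2, ?_⟩
  filter_upwards [hmem] with t ⟨hts, ht1⟩
  have ht2 : γ₂ t ∈ e.source := by
    rw [hs, mem_preimage, ← hπ t hts, ← mem_preimage, ← hs]
    exact ht1
  have hsnd : ∀ γ : ℝ → P, ContMDiffOn 𝓘(ℝ, ℝ) 𝓘(ℝ, EP) ∞ γ s → γ t ∈ e.source →
      ContMDiffWithinAt 𝓘(ℝ, ℝ) 𝓘(ℝ, EG) ∞ (fun t => (e (γ t)).2) s t := fun γ hγ h =>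
    (contMDiffAt_snd (I := 𝓘(ℝ, EB)) (J := 𝓘(ℝ, EG))).comp_contMDiffWithinAt t
      (((hsm _ h).contMDiffAt (e.open_source.mem_nhds h)).comp_contMDiffWithinAt t (hγ t hts))
  refine ⟨(((hsnd γ₁ h₁ ht1).inv).mul (hsnd γ₂ h₂ ht2)).mdifferentiableWithinAt (by simp), ?_⟩
  obtain ⟨ha, hb, hc⟩ := he (γ₁ t) ht1 ((e (γ₁ t)).2⁻¹ * (e (γ₂ t)).2)
  refine e.injOn ht2 ha ?_
  rw [hc, mul_inv_cancel_left]
  refine Prod.ext ?_ rfl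
  rw [(he (γ₂ t) ht2 1).2.1, hb, hπ t hts]

variable [IsManifold 𝓘(ℝ, EP) ∞ P]

theorem lieAd_zero (g : G) : lieAd g (0 : GroupLieAlgebra 𝓘(ℝ, EG) G) = 0 :=
  map_zero (mfderiv 𝓘(ℝ, EG) 𝓘(ℝ, EG) (fun h : G => g * h * g⁻¹) 1)

theorem IsHorizontalLift.smul (hξ : IsPrincipalBundle (EG := EG) G (EB := EB) (EP := EP) π)
    {A : Connection (EG := EG) G (EP := EP) P} {w : ℝ → B} {q : P} {γ : ℝ → P}
    (hγ : IsHorizontalLift π A w q γ) (g : G) :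
    IsHorizontalLift π A w (MulOpposite.op g • q) (fun t => MulOpposite.op g • γ t) where
  smooth := (hξ.contMDiff_smul g).comp_contMDiffOn hγ.smooth
  start := by rw [hγ.start]
  lifts t ht := by rw [hξ.proj_smul, hγ.lifts t ht]
  horizontal t ht := by
    have hγd := (hγ.smooth t ht).mdifferentiableWithinAt (by simp)
    have hu : UniqueMDiffWithinAt 𝓘(ℝ, ℝ) (Icc (0 : ℝ) 1) t :=
      ((uniqueDiffOn_Icc_zero_one) t ht).uniqueMDiffWithinAt
    have hc := mfderiv_comp_mfderivWithin (x := t)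
      ((hξ.contMDiff_smul g).mdifferentiable (by simp) (γ t)) hγd hu
    have he := A.equivariant g (γ t) (mfderivWithin 𝓘(ℝ, ℝ) 𝓘(ℝ, EP) γ (Icc 0 1) t (1 : ℝ))
    rw [hγ.horizontal t ht, lieAd_zero] at he
    change A.form _ (mfderivWithin 𝓘(ℝ, ℝ) 𝓘(ℝ, EP) ((fun p : P => MulOpposite.op g • p) ∘ γ)
      (Icc 0 1) t (1 : ℝ)) = 0
    rw [hc]
    exact he

/-- If a curve in the group that passes through `1` takes a horizontal curve to a horizontal curve,
then its velocity at `1` vanishes. -/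
theorem IsPrincipalBundle.mfderivWithin_translation_eq_zero
    (hξ : IsPrincipalBundle (EG := EG) G (EB := EB) (EP := EP) π)
    (A : Connection (EG := EG) G (EP := EP) P) {s : Set ℝ} {t : ℝ} (hts : t ∈ s)
    (hu : UniqueDiffWithinAt ℝ s t) {γ₁ γ₂ : ℝ → P} {k : ℝ → G}
    (h₁ : MDifferentiableWithinAt 𝓘(ℝ, ℝ) 𝓘(ℝ, EP) γ₁ s t)
    (hA₁ : A.form (γ₁ t) (mfderivWithin 𝓘(ℝ, ℝ) 𝓘(ℝ, EP) γ₁ s t (1 : ℝ)) = 0)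
    (hA₂ : A.form (γ₂ t) (mfderivWithin 𝓘(ℝ, ℝ) 𝓘(ℝ, EP) γ₂ s t (1 : ℝ)) = 0)
    (hk : MDifferentiableWithinAt 𝓘(ℝ, ℝ) 𝓘(ℝ, EG) k s t) (hk1 : k t = 1)
    (hkγ : ∀ᶠ u in 𝓝[s] t, γ₂ u = MulOpposite.op (k u) • γ₁ u) :
    mfderivWithin 𝓘(ℝ, ℝ) 𝓘(ℝ, EG) k s t (1 : ℝ) = 0 := by
  have hum : UniqueMDiffWithinAt 𝓘(ℝ, ℝ) s t := hu.uniqueMDiffWithinAt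
  have hpt : γ₂ t = γ₁ t := by
    rw [hkγ.self_of_nhdsWithin hts, hk1, MulOpposite.op_one, one_smul]
  have hact : MDifferentiableAt (𝓘(ℝ, EP).prod 𝓘(ℝ, EG)) 𝓘(ℝ, EP)
      (fun x : P × G => MulOpposite.op x.2 • x.1) (γ₁ t, k t) :=
    hξ.smooth_action.mdifferentiable (by simp) _
  have hD : mfderivWithin 𝓘(ℝ, ℝ) 𝓘(ℝ, EP) γ₂ s t =
      mfderivWithin 𝓘(ℝ, ℝ) 𝓘(ℝ, EP)
        ((fun x : P × G => MulOpposite.op x.2 • x.1) ∘ fun u => (γ₁ u, k u)) s t :=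
    Filter.EventuallyEq.mfderivWithin_eq hkγ (hkγ.self_of_nhdsWithin hts)
  have hc := hact.hasMFDerivAt.comp_hasMFDerivWithinAt t
    (h₁.hasMFDerivWithinAt.prodMk hk.hasMFDerivWithinAt)
  rw [hc.mfderivWithin hum] at hD
  -- Product rule for the action at group element `1`: the velocity of `γ₂` is that of `γ₁` plus the
  -- vertical vector generated by the velocity of `k`. The connection form kills both velocities and
  -- returns the generator of the vertical vector, so that generator is zero.
  have hsplit : ∀ g : G, g = 1 → ∀ (v : EP) (w : EG),
      (mfderiv (𝓘(ℝ, EP).prod 𝓘(ℝ, EG)) 𝓘(ℝ, EP)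
        (fun x : P × G => MulOpposite.op x.2 • x.1) (γ₁ t, g) (v, w) : EP) =
      v + id (α := EP)
        (mfderiv 𝓘(ℝ, EG) 𝓘(ℝ, EP) (fun g : G => MulOpposite.op g • γ₁ t) 1 w) := by
    rintro g rfl v w
    have h := mfderiv_prod_eq_add_apply (v := (v, w))
      (hξ.smooth_action.mdifferentiable (by simp) (γ₁ t, (1 : G)))
    have hid : (fun z : P => MulOpposite.op (1 : G) • z) = id := by
      funext z
      rw [MulOpposite.op_one, one_smul, id]
    have hone : (mfderiv 𝓘(ℝ, EP) 𝓘(ℝ, EP)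
        (fun z : P => MulOpposite.op (1 : G) • z) (γ₁ t) v : EP) = v := by
      rw [hid, mfderiv_id]
      rfl
    refine h.trans ?_
    change id (α := EP) (mfderiv 𝓘(ℝ, EP) 𝓘(ℝ, EP)
        (fun z : P => MulOpposite.op (1 : G) • z) (γ₁ t) v) + _ = _
    exact congrArg (fun u : EP => u + id (α := EP)
      (mfderiv 𝓘(ℝ, EG) 𝓘(ℝ, EP) (fun g : G => MulOpposite.op g • γ₁ t) 1 w)) hone
  have hvel : (mfderivWithin 𝓘(ℝ, ℝ) 𝓘(ℝ, EP) γ₂ s t (1 : ℝ) : EP) =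
      id (α := EP) (mfderivWithin 𝓘(ℝ, ℝ) 𝓘(ℝ, EP) γ₁ s t (1 : ℝ)) +
        id (α := EP) (mfderiv 𝓘(ℝ, EG) 𝓘(ℝ, EP) (fun g : G => MulOpposite.op g • γ₁ t) 1
          (mfderivWithin 𝓘(ℝ, ℝ) 𝓘(ℝ, EG) k s t (1 : ℝ) : EG)) := by
    rw [hD]
    exact hsplit (k t) hk1 _ _
  -- Transports the form along equalities of base points: `γ₂ t = γ₁ t` here, and `p · 1 = p` for
  -- the axiom `vertical`.
  have hpoint : ∀ p p' : P, p' = p → ∀ v : EP, A.form p' v = A.form p v := by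
    rintro p _ rfl v
    rfl
  have hadd := map_add (A.form (γ₁ t)) (mfderivWithin 𝓘(ℝ, ℝ) 𝓘(ℝ, EP) γ₁ s t (1 : ℝ))
    (mfderiv 𝓘(ℝ, EG) 𝓘(ℝ, EP) (fun g : G => MulOpposite.op g • γ₁ t) 1
      (mfderivWithin 𝓘(ℝ, ℝ) 𝓘(ℝ, EG) k s t (1 : ℝ) : EG) : EP)
  have hv := A.vertical (γ₁ t) (mfderivWithin 𝓘(ℝ, ℝ) 𝓘(ℝ, EG) k s t (1 : ℝ) : EG)
  have hA₂' := (hpoint _ _ hpt _).symm.trans hA₂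
  rw [hA₁, zero_add] at hadd
  refine hv.symm.trans ?_
  refine (hpoint _ _ (by rw [MulOpposite.op_one, one_smul]) _).trans (hadd.symm.trans ?_)
  exact (congrArg (fun v : EP => A.form (γ₁ t) v) hvel.symm).trans hA₂'

/-- Horizontal lifts are unique. -/
theorem IsHorizontalLift.apply_one_eq [LieGroup 𝓘(ℝ, EG) ∞ G]
    (hξ : IsPrincipalBundle (EG := EG) G (EB := EB) (EP := EP) π)
    {A : Connection (EG := EG) G (EP := EP) P} {w : ℝ → B} {q : P} {γ₁ γ₂ : ℝ → P}
    (h₁ : IsHorizontalLift π A w q γ₁) (h₂ : IsHorizontalLift π A w q γ₂) : γ₁ 1 = γ₂ 1 := by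
  have hπ : ∀ t ∈ Icc (0 : ℝ) 1, π (γ₁ t) = π (γ₂ t) := fun t ht => by
    rw [h₁.lifts t ht, h₂.lifts t ht]
  -- The truth value of `γ₁ t = γ₂ t` is shown to be locally constant, which yields openness and
  -- closedness of the coincidence set together.
  have hloc : ∀ t₀ ∈ Icc (0 : ℝ) 1, ∀ᶠ t in 𝓝[Icc 0 1] t₀,
      (γ₁ t = γ₂ t) = (γ₁ t₀ = γ₂ t₀) := by
    intro t₀ ht₀
    obtain ⟨k, hk⟩ := hξ.exists_translation h₁.smooth h₂.smooth hπ ht₀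
    have hconst : ∀ᶠ t in 𝓝[Icc 0 1] t₀, k t = k t₀ := by
      refine eventually_eq_of_mfderivWithin_eq_zero (E := EG) (convex_Icc 0 1) ht₀ ?_
      filter_upwards [eventually_eventually_nhdsWithin.2 hk, self_mem_nhdsWithin] with t hkt ht
      have hkd := (hkt.self_of_nhdsWithin ht).1
      refine ⟨hkd, ?_⟩
      -- Replacing `γ₁` by its horizontal translate `γ₁ · k t` normalizes the difference curve to
      -- `(k t)⁻¹ k`, which passes through `1` at `t`. Left translation by `k t` then carries its
      -- zero velocity back to `k`.
      have h₁' := h₁.smul hξ (k t)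
      have hL : MDifferentiable 𝓘(ℝ, EG) 𝓘(ℝ, EG) (fun g : G => (k t)⁻¹ * g) :=
        (contMDiff_mul_left (I := 𝓘(ℝ, EG)) (n := ∞)).mdifferentiable (by simp)
      have hL' : MDifferentiable 𝓘(ℝ, EG) 𝓘(ℝ, EG) (fun g : G => k t * g) :=
        (contMDiff_mul_left (I := 𝓘(ℝ, EG)) (n := ∞)).mdifferentiable (by simp)
      have hu : UniqueDiffWithinAt ℝ (Icc (0 : ℝ) 1) t := uniqueDiffOn_Icc_zero_one t ht
      have hk'd : MDifferentiableWithinAt 𝓘(ℝ, ℝ) 𝓘(ℝ, EG) (fun u => (k t)⁻¹ * k u)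
          (Icc 0 1) t := (hL (k t)).comp_mdifferentiableWithinAt t hkd
      have h0 := hξ.mfderivWithin_translation_eq_zero A ht hu
        ((h₁'.smooth t ht).mdifferentiableWithinAt (by simp)) (h₁'.horizontal t ht)
        (h₂.horizontal t ht) hk'd (inv_mul_cancel _) (by
          filter_upwards [hkt] with u hu
          rw [hu.2, smul_smul, ← MulOpposite.op_mul, mul_inv_cancel_left])
      have hk_eq : k = (fun g : G => k t * g) ∘ fun u => (k t)⁻¹ * k u := by
        funext u
        simp
      have hc := mfderiv_comp_mfderivWithin (x := t) (hL' ((k t)⁻¹ * k t)) hk'd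
        hu.uniqueMDiffWithinAt
      have hc1 := congrArg (fun L : ℝ →L[ℝ] EG => L 1) hc
      have hz := map_zero (mfderiv 𝓘(ℝ, EG) 𝓘(ℝ, EG) (fun g : G => k t * g) ((k t)⁻¹ * k t))
      have hd : ∀ κ : ℝ → G, k = κ →
          (mfderivWithin 𝓘(ℝ, ℝ) 𝓘(ℝ, EG) k (Icc 0 1) t (1 : ℝ) : EG) =
            mfderivWithin 𝓘(ℝ, ℝ) 𝓘(ℝ, EG) κ (Icc 0 1) t (1 : ℝ) := by
        rintro _ rfl
        rfl
      refine (hd _ hk_eq).trans (hc1.trans ?_)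
      exact (congrArg (mfderiv 𝓘(ℝ, EG) 𝓘(ℝ, EG) (fun g : G => k t * g) ((k t)⁻¹ * k t)) h0).trans hz
    have hfix : ∀ (g : G) (p : P), p = MulOpposite.op g • p ↔ g = 1 := fun g p => by
      constructor
      · intro h
        refine (hξ.smul_left_injective p ?_)
        rw [← h, MulOpposite.op_one, one_smul]
      · rintro rfl
        rw [MulOpposite.op_one, one_smul]
    -- By freeness the lifts agree at `t` exactly when `k t = 1`, and `k` is constant near `t₀`.
    filter_upwards [hk, hconst] with t ht htc
    rw [ht.2, (hk.self_of_nhdsWithin ht₀).2, htc, hfix, hfix]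
  have hlc : IsLocallyConstant (fun t : Icc (0 : ℝ) 1 => (γ₁ t = γ₂ t)) := by
    rw [IsLocallyConstant.iff_eventually_eq]
    rintro ⟨t₀, ht₀⟩
    rw [nhds_subtype_eq_comap_nhdsWithin]
    exact (hloc t₀ ht₀).comap _
  have := hlc.apply_eq_of_isPreconnected isPreconnected_univ
    (mem_univ (⟨0, by simp⟩ : Icc (0 : ℝ) 1)) (mem_univ (⟨1, by simp⟩ : Icc (0 : ℝ) 1))
  exact this.mp (h₁.start.trans h₂.start.symm)

/-! ### Holonomy and change of reference point -/

theorem IsHolonomy.unique [LieGroup 𝓘(ℝ, EG) ∞ G]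
    (hξ : IsPrincipalBundle (EG := EG) G (EB := EB) (EP := EP) π)
    {A : Connection (EG := EG) G (EP := EP) P} {w : ℝ → B} {q : P} {g h : G}
    (hg : IsHolonomy π A w q g) (hh : IsHolonomy π A w q h) : g = h := by
  obtain ⟨γ₁, h₁, e₁⟩ := hg
  obtain ⟨γ₂, h₂, e₂⟩ := hh
  exact hξ.smul_left_injective q (by rw [← e₁, ← e₂, h₁.apply_one_eq hξ h₂])

theorem IsHolonomy.smul (hξ : IsPrincipalBundle (EG := EG) G (EB := EB) (EP := EP) π)
    {A : Connection (EG := EG) G (EP := EP) P} {w : ℝ → B} {q : P} {g : G}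
    (hg : IsHolonomy π A w q g) (x : G) :
    IsHolonomy π A w (MulOpposite.op x • q) (x⁻¹ * g * x) := by
  obtain ⟨γ, hγ, e⟩ := hg
  refine ⟨_, hγ.smul hξ x, ?_⟩
  rw [e, smul_smul, smul_smul, ← MulOpposite.op_mul, ← MulOpposite.op_mul]
  congr 2
  group

theorem hol_eq_of_isHolonomy [LieGroup 𝓘(ℝ, EG) ∞ G]
    (hξ : IsPrincipalBundle (EG := EG) G (EB := EB) (EP := EP) π)
    {A : Connection (EG := EG) G (EP := EP) P} {w : ℝ → B} {q : P} {g : G}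
    (hg : IsHolonomy π A w q g) : hol π A w q = g := by
  have h : ∃ g : G, IsHolonomy π A w q g := ⟨g, hg⟩
  rw [hol, dif_pos h]
  exact h.choose_spec.unique hξ hg

/-- The dependence of the holonomy on the reference point. -/
theorem hol_eq_conj [LieGroup 𝓘(ℝ, EG) ∞ G]
    (hξ : IsPrincipalBundle (EG := EG) G (EB := EB) (EP := EP) π)
    (A : Connection (EG := EG) G (EP := EP) P) (w : ℝ → B) (q : P) (x : G) :
    hol π A w q = x * hol π A w (MulOpposite.op x • q) * x⁻¹ := by
  by_cases h : ∃ g : G, IsHolonomy π A w q g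
  · obtain ⟨g, hg⟩ := h
    rw [hol_eq_of_isHolonomy hξ hg, hol_eq_of_isHolonomy hξ (hg.smul hξ x)]
    group
  -- Translating back by `x⁻¹` shows that holonomy fails to exist at both points simultaneously;
  -- both values are then the default `1`.
  · have h' : ¬ ∃ g : G, IsHolonomy π A w (MulOpposite.op x • q) g := by
      rintro ⟨g, hg⟩
      have hx := hg.smul hξ x⁻¹
      rw [smul_smul, ← MulOpposite.op_mul, mul_inv_cancel, MulOpposite.op_one, one_smul] at hx
      exact h ⟨_, hx⟩
    rw [hol, dif_neg h, hol, dif_neg h', mul_one, mul_inv_cancel]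

theorem BasedClasses.hol_eq_conj [LieGroup 𝓘(ℝ, EG) ∞ G]
    (hξ : IsPrincipalBundle (EG := EG) G (EB := EB) (EP := EP) π) {Q : B}
    (b : BasedClasses EG G (EP := EP) π Q) (w : ℝ → B) (q : P) (hq : π q = Q) (x : G) :
    b.hol w q hq =
      x * b.hol w (MulOpposite.op x • q) ((hξ.proj_smul x q).trans hq) * x⁻¹ := by
  induction b using Quot.ind with
  | mk A => exact YangMillsWilson.hol_eq_conj hξ A w q x

end HorizontalLifts

end YangMillsWilson

theorem mainTheorem11
    {EG : Type*} [NormedAddCommGroup EG] [NormedSpace ℝ EG] [FiniteDimensional ℝ EG]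
    {G : Type*} [TopologicalSpace G] [ChartedSpace EG G] [Group G] [LieGroup 𝓘(ℝ, EG) ∞ G]
    [T2Space G] [CompactSpace G] [ConnectedSpace G]
    {S : Type*} [TopologicalSpace S] [ChartedSpace (EuclideanSpace ℝ (Fin 2)) S]
    [IsManifold (𝓡 2) ∞ S] [T2Space S] [CompactSpace S] [ConnectedSpace S]
    {l : ℕ} (hl : 1 ≤ l) {Q : S} (c : CanonicalSystem l Q)
    {EM : Type*} [NormedAddCommGroup EM] [NormedSpace ℝ EM] [FiniteDimensional ℝ EM]
    {M : Type*} [TopologicalSpace M] [ChartedSpace EM M] [IsManifold 𝓘(ℝ, EM) ∞ M]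
    [MulAction Circleᵐᵒᵖ M]
    {Mt : Type*} [TopologicalSpace Mt] [SimplyConnectedSpace Mt]
    (R : ReferenceBundle c EM M Mt)
    {EP : Type*} [NormedAddCommGroup EP] [NormedSpace ℝ EP] [FiniteDimensional ℝ EP]
    {P : Type*} [TopologicalSpace P] [ChartedSpace EP P] [IsManifold 𝓘(ℝ, EP) ∞ P]
    [MulAction Gᵐᵒᵖ P]
    (π : P → S)
    (hξ : IsPrincipalBundle (EG := EG) G (EB := EuclideanSpace ℝ (Fin 2)) (EP := EP) π)
    (X : GroupLieAlgebra 𝓘(ℝ, EG) G) (hX : R.IsCharClass π X)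
    (q : P) (hq : π q = Q) (x : G) :
    CYM (EP := EP) R.vol X q hq = CYM (EP := EP) R.vol X (MulOpposite.op x • q) ((hξ.proj_smul x q).trans hq) ∧
    (∀ b : BasedClasses EG G (EP := EP) π Q,
      wilson c q hq b = conjTuple x (wilson c (MulOpposite.op x • q) ((hξ.proj_smul x q).trans hq) b)) ∧
    ∃ κ : homComponent R π X ≃ₜ homComponent R π X,
      (∀ a, (κ a : Gen l → G) = conjTuple x a) ∧
      IsStratifiedIso EG κ ∧
      ∀ (f : CYM (EP := EP) R.vol X q hq → homComponent R π X)
        (f' : CYM (EP := EP) R.vol X (MulOpposite.op x • q) ((hξ.proj_smul x q).trans hq) → homComponent R π X),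
        (∀ b, (f b : Gen l → G) = wilson c q hq b.1) →
        (∀ b, (f' b : Gen l → G) = wilson c (MulOpposite.op x • q) ((hξ.proj_smul x q).trans hq) b.1) →
        ∀ (b : BasedClasses EG G (EP := EP) π Q) (h : b ∈ CYM (EP := EP) R.vol X q hq)
          (h' : b ∈ CYM (EP := EP) R.vol X (MulOpposite.op x • q) ((hξ.proj_smul x q).trans hq)),
          f ⟨b, h⟩ = κ (f' ⟨b, h'⟩) := by
  have : IsTopologicalGroup G := topologicalGroup_of_lieGroup 𝓘(ℝ, EG) ∞
  have hwilson : ∀ b : BasedClasses EG G (EP := EP) π Q, wilson c q hq b = conjTuple x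
      (wilson c (MulOpposite.op x • q) ((hξ.proj_smul x q).trans hq) b) := fun b =>
    funext fun i => b.hol_eq_conj hξ (c.curve i) q hq x
  have hH := homComponent_conjTuple R π hX.1
  refine ⟨?_, hwilson, conjOn hH x, fun _ => rfl, isStratifiedIso_conjOn EG hH x, ?_⟩
  · ext b
    refine forall₂_congr fun Δ _ => ?_
    rw [constraint, constraint, mul_inv_eq_one, mul_inv_eq_one, b.hol_eq_conj hξ _ q hq x]
    -- Writing the central element `exp (a_Δ X)` as its own conjugate by `x` lets `x` cancel from
    -- both sides of the constraint.
    conv_lhs => rw [← mul_lieExp_mul_inv hX.1 (diskArea R.vol Δ) x, mul_left_inj, mul_right_inj]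
  · intro f f' hf hf' b h h'
    refine Subtype.ext ?_
    rw [coe_conjOn, hf, hf']
    exact hwilson b
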